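/- Let $\mathbb M^n=(\mathbb R^n,\|\cdot\|)$, $n\ge 1$, be a Minkowski space (an $n$-dimensional real normed space) with unit ball $\mathbb B$. A convex body is a compact convex set with more than one point. For a convex body $K$ let $D(K)=\sup_{x,y\in K}\|x-y\|$, let $R(K)=\inf\{\rho>0:\exists c,\ K\subset c+\rho\mathbb B\}$, let $j(K)=R(K)/D(K)$, and let $s(K)=\inf\{\rho>0:\exists c,\ -K\subset c+\rho K\}$ be its Minkowski asymmetry. A convex body $K$ is complete if $D(K\cup\{x\})>D(K)$ for all $x\notin K$; it is a completion of $S\subset K$ if it is complete and $D(K)=D(S)$. Put $j(\mathbb M^n)=\sup_K j(K)$ over all convex bodies $K$ and $s(\mathbb M^n)=\sup_K s(K)$ over all complete bodies $K$. Then: (i) every complete body $K$ satisfies $j(K)=\dfrac{s(K)}{s(K)+1}$; (ii) both suprema are maxima, and $j(\mathbb M^n)=\dfrac{s(\mathbb M^n)}{s(\mathbb M^n)+1}$; (iii) a complete body $K$ satisfies $j(K)=j(\mathbb M^n)$ if and only if $K$ is a completion of a possibly degenerate $n$-simplex $S$ (the convex hull of $n+1$ points, which need not be affinely independent) with $j(S)=j(\mathbb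 M^n)$. -/

import Mathlib

open scoped Pointwise

namespace MinkowskiSpace

section Sets

variable {E : Type*} [NormedAddCommGroup E] [NormedSpace ℝ E]

/-- Convex bodies: compact convex sets, possibly with empty interior.  Single points are left out,
since their diameter is zero and the ratio of circumradius to diameter is not defined. -/
def IsConvexBody (K : Set E) : Prop :=
  IsCompact K ∧ Convex ℝ K ∧ K.Nontrivial

/-- The circumradius: the infimum of the radii of the balls that contain `K`. -/
noncomputable def circumradius (K : Set E) : ℝ :=
  sInf {ρ : ℝ | 0 < ρ ∧ ∃ c : E, K ⊆ Metric.closedBall c ρ}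

/-- The Jung ratio: circumradius over diameter. -/
noncomputable def jungRatio (K : Set E) : ℝ :=
  circumradius K / Metric.diam K

/-- The Minkowski asymmetry: the infimum of the dilatation factors `ρ > 0` such that a translate
of `ρ K` contains `-K`. -/
noncomputable def asymmetry (K : Set E) : ℝ :=
  sInf {ρ : ℝ | 0 < ρ ∧ ∃ c : E, -K ⊆ {c} + ρ • K}

/-- Complete bodies: adding any further point increases the diameter. -/
def IsCompleteBody (K : Set E) : Prop :=
  IsConvexBody K ∧ ∀ x, x ∉ K → Metric.diam K < Metric.diam (K ∪ {x})

/-- `K` is a completion of `S`. -/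
def IsCompletion (S K : Set E) : Prop :=
  S ⊆ K ∧ IsCompleteBody K ∧ Metric.diam K = Metric.diam S

end Sets

section Constants

variable (E : Type*) [NormedAddCommGroup E] [NormedSpace ℝ E]

/-- The Jung constant of the space: the supremum of the Jung ratios of its convex bodies. -/
noncomputable def jungConstant : ℝ :=
  sSup {t : ℝ | ∃ K : Set E, IsConvexBody K ∧ t = jungRatio K}

/-- The asymmetry constant of the space: the supremum of the Minkowski asymmetries of its complete
bodies. -/
noncomputable def asymmetryConstant : ℝ :=
  sSup {t : ℝ | ∃ K : Set E, IsCompleteBody K ∧ t = asymmetry K}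

end Constants

end MinkowskiSpace

namespace MinkowskiSpace

open Metric Module

/-! ### Circumradius and Bohnenblust's inequality -/

section Circumradius

variable {E : Type*} [NormedAddCommGroup E]

/-! Let `K` be complete with diameter D. If `K` lies in a ball of radius r < D about c, the ball of
radius D - r about c lies in `K`, so `-K` fits in a translate of (r / (D - r)) `K`; letting r
decrease to R gives s ≤ R / (D - R). Conversely, an inclusion of `-K` in a translate of ρ `K` bounds
R by ρ / (ρ + 1) · D. Together these give (i), once R < D is known.

Helly's theorem finds n + 1 points of a body with the same circumradius, so Jung ratios are
controlled by simplices. Compactness yields an extremal simplex, and Bohnenblust's inequality puts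
its ratio below 1. Completing it keeps the diameter without decreasing R, so complete bodies attain
the Jung constant; monotonicity of t / (t + 1) carries this to the asymmetry. -/

theorem circumradius_nonneg (K : Set E) : 0 ≤ circumradius K :=
  Real.sInf_nonneg fun _ h => h.1.le

theorem circumradius_le {K : Set E} {c : E} {r : ℝ} (hr : 0 < r) (h : K ⊆ closedBall c r) :
    circumradius K ≤ r :=
  csInf_le ⟨0, fun _ h => h.1.le⟩ ⟨hr, c, h⟩

theorem exists_ball_of_circumradius_lt {K : Set E} (hK : Bornology.IsBounded K) {r : ℝ}
    (h : circumradius K < r) : ∃ c : E, K ⊆ closedBall c r := by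
  have hne : {ρ : ℝ | 0 < ρ ∧ ∃ c : E, K ⊆ closedBall c ρ}.Nonempty := by
    obtain ⟨ρ, hρ, hs⟩ := hK.subset_closedBall_lt 0 0
    exact ⟨ρ, hρ, 0, hs⟩
  obtain ⟨ρ, ⟨_, c, hc⟩, hlt⟩ := exists_lt_of_csInf_lt hne h
  exact ⟨c, hc.trans (closedBall_subset_closedBall hlt.le)⟩

theorem circumradius_mono {S K : Set E} (hK : Bornology.IsBounded K) (h : S ⊆ K) :
    circumradius S ≤ circumradius K := by
  refine le_of_forall_gt_imp_ge_of_dense fun r hr => ?_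
  obtain ⟨c, hc⟩ := exists_ball_of_circumradius_lt hK hr
  exact circumradius_le ((circumradius_nonneg K).trans_lt hr) (h.trans hc)

theorem circumradius_convexHull [NormedSpace ℝ E] (S : Set E) :
    circumradius (convexHull ℝ S) = circumradius S := by
  simp only [circumradius, (convex_closedBall _ _).convexHull_subset_iff]

theorem diam_le_two_mul_circumradius {K : Set E} (hK : Bornology.IsBounded K) :
    diam K ≤ 2 * circumradius K := by
  have : diam K / 2 ≤ circumradius K := by
    refine le_of_forall_gt_imp_ge_of_dense fun r hr => ?_
    obtain ⟨c, hc⟩ := exists_ball_of_circumradius_lt hK hr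
    have h0 := (circumradius_nonneg K).trans hr.le
    have := (diam_mono hc isBounded_closedBall).trans (diam_closedBall h0)
    linarith
  linarith

theorem isBounded_range {ι : Type*} [Finite ι] (p : ι → E) :
    Bornology.IsBounded (Set.range p) :=
  (Set.finite_range p).isBounded

theorem lipschitzWith_circumradius_range {ι : Type*} [Fintype ι] :
    LipschitzWith 1 fun p : ι → E => circumradius (Set.range p) := by
  refine LipschitzWith.of_le_add fun p q => ?_
  rw [← sub_le_iff_le_add]
  refine le_of_forall_gt_imp_ge_of_dense fun r hr => ?_
  obtain ⟨c, hc⟩ := exists_ball_of_circumradius_lt (isBounded_range q) hr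
  rw [sub_le_iff_le_add]
  refine circumradius_le (c := c) (add_pos_of_pos_of_nonneg
    ((circumradius_nonneg _).trans_lt hr) dist_nonneg) ?_
  rintro _ ⟨i, rfl⟩
  have h1 : dist (q i) c ≤ r := hc ⟨i, rfl⟩
  have h2 := dist_le_pi_dist p q i
  have h3 := dist_triangle (p i) (q i) c
  rw [mem_closedBall]
  linarith

/-- Bohnenblust's inequality for finitely many points. -/
theorem circumradius_range_le [NormedSpace ℝ E] {n : ℕ} (hn : 1 ≤ n) {p : Fin (n + 1) → E} {D : ℝ}
    (hD : 0 < D) (h : ∀ i j, dist (p i) (p j) ≤ D) :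
    circumradius (Set.range p) ≤ n / (n + 1) * D := by
  have hn0 : (0 : ℝ) < n := by exact_mod_cast hn
  have hn1 : (0 : ℝ) < n + 1 := by positivity
  -- The centre is the centroid: `p i` minus it averages n + 1 differences, one of which vanishes.
  refine circumradius_le (c := (n + 1 : ℝ)⁻¹ • ∑ j, p j) (by positivity) ?_
  rintro _ ⟨i, rfl⟩
  rw [mem_closedBall, dist_eq_norm]
  have e : p i - (n + 1 : ℝ)⁻¹ • ∑ j, p j = (n + 1 : ℝ)⁻¹ • ∑ j, (p i - p j) := by
    rw [Finset.sum_sub_distrib, smul_sub, Finset.sum_const, Finset.card_univ, Fintype.card_fin,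
      ← Nat.cast_smul_eq_nsmul ℝ, smul_smul]
    push_cast
    rw [inv_mul_cancel₀ hn1.ne', one_smul]
  rw [e, norm_smul, norm_inv, Real.norm_of_nonneg hn1.le, ← Finset.sum_erase_add _ _
    (Finset.mem_univ i), sub_self, add_zero, div_mul_eq_mul_div, inv_mul_eq_div]
  gcongr
  refine (norm_sum_le_of_le _ fun j _ => ((dist_eq_norm (p i) (p j)).symm.trans_le (h i j))).trans ?_
  simp

theorem circumradius_image_smul_add_le [NormedSpace ℝ E] {K : Set E} (hK : Bornology.IsBounded K)
    {a : ℝ} (ha : 0 < a) (b : E) :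
    circumradius ((fun x => a • x + b) '' K) ≤ a * circumradius K := by
  rw [← div_le_iff₀' ha]
  refine le_of_forall_gt_imp_ge_of_dense fun r hr => ?_
  obtain ⟨c, hc⟩ := exists_ball_of_circumradius_lt hK hr
  rw [div_le_iff₀' ha]
  refine circumradius_le (c := a • c + b)
    (mul_pos ha ((circumradius_nonneg _).trans_lt hr)) ?_
  rintro _ ⟨x, hx, rfl⟩
  rw [mem_closedBall, dist_add_right, dist_smul₀, Real.norm_of_nonneg ha.le]
  exact mul_le_mul_of_nonneg_left (hc hx) ha.le

theorem nontrivial_of_circumradius_pos {K : Set E} (h : 0 < circumradius K) : K.Nontrivial := by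
  by_contra hs
  rw [Set.not_nontrivial_iff] at hs
  obtain ⟨c, hc⟩ : ∃ c, K ⊆ {c} := by
    rcases hs.eq_empty_or_singleton with rfl | ⟨c, rfl⟩
    · exact ⟨0, Set.empty_subset _⟩
    · exact ⟨c, subset_rfl⟩
  have := circumradius_le (half_pos h) (hc.trans
    (Set.singleton_subset_iff.2 (mem_closedBall_self (half_pos h).le)))
  linarith

end Circumradius

section ConvexBodies

variable {E : Type*} [NormedAddCommGroup E] [NormedSpace ℝ E]

theorem isConvexBody_convexHull_range {ι : Type*} [Finite ι] {p : ι → E}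
    (h : (Set.range p).Nontrivial) : IsConvexBody (convexHull ℝ (Set.range p)) :=
  ⟨(Set.finite_range p).isCompact_convexHull (𝕜 := ℝ), convex_convexHull ℝ _,
    h.mono (subset_convexHull ℝ _)⟩

theorem IsConvexBody.diam_pos {K : Set E} (hK : IsConvexBody K) : 0 < diam K :=
  Metric.diam_pos hK.2.2 hK.1.isBounded

theorem jungRatio_convexHull (S : Set E) :
    jungRatio (convexHull ℝ S) = circumradius S / diam S := by
  rw [jungRatio, circumradius_convexHull, convexHull_diam]

end ConvexBodies

/-! ### Reduction to simplices and the extremal simplex -/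

section Simplices

variable {E : Type*} [NormedAddCommGroup E] [NormedSpace ℝ E] [FiniteDimensional ℝ E]

/-- Maximise the circumradius over (n + 1)-tuples in `K`. For r above the maximum, any n + 1 balls
of radius r centred in `K` meet, so by Helly all do, and a common point is the centre of an r-ball
containing `K`. -/
theorem exists_simplex_circumradius_eq {n : ℕ} (hE : finrank ℝ E = n) {K : Set E}
    (hK : IsCompact K) (hne : K.Nonempty) :
    ∃ p : Fin (n + 1) → E, (∀ i, p i ∈ K) ∧ circumradius (Set.range p) = circumradius K := by
  have hX : IsCompact (Set.univ.pi fun _ : Fin (n + 1) => K) := isCompact_univ_pi fun _ => hK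
  obtain ⟨p, hp, hmax⟩ := hX.exists_isMaxOn (Set.univ_pi_nonempty_iff.2 fun _ => hne)
    (lipschitzWith_circumradius_range (E := E)).continuous.continuousOn
  rw [Set.mem_univ_pi] at hp
  refine ⟨p, hp, le_antisymm (circumradius_mono hK.isBounded (Set.range_subset_iff.2 hp)) ?_⟩
  refine le_of_forall_gt_imp_ge_of_dense fun r hr => ?_
  have h0 : 0 < r := (circumradius_nonneg _).trans_lt hr
  have key : (⋂ x : K, closedBall (x : E) r).Nonempty := by
    refine Convex.helly_theorem_compact' (𝕜 := ℝ) (fun x => convex_closedBall _ _)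
      (fun x => isCompact_closedBall _ _) fun I hI => ?_
    rcases I.eq_empty_or_nonempty with rfl | hIne
    · simp
    obtain ⟨e⟩ : Nonempty (I ↪ Fin (n + 1)) :=
      Function.Embedding.nonempty_of_card_le (by simpa [hE] using hI)
    have : Nonempty I := hIne.to_subtype
    -- `I` may have fewer than n + 1 elements; `invFun` pads the tuple by repetition.
    let q : Fin (n + 1) → E := fun i => ((Function.invFun e i : I) : K)
    have hq : circumradius (Set.range q) ≤ circumradius (Set.range p) :=
      hmax (Set.mem_univ_pi.2 fun i => ((Function.invFun e i : I) : K).2)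
    obtain ⟨c, hc⟩ := exists_ball_of_circumradius_lt (isBounded_range q) (hq.trans_lt hr)
    refine ⟨c, Set.mem_iInter₂.2 fun x hx => ?_⟩
    have hqx : q (e ⟨x, hx⟩) = x := by
      simp only [q, Function.leftInverse_invFun e.injective _]
    have := hc ⟨e ⟨x, hx⟩, rfl⟩
    rwa [hqx, mem_closedBall_comm] at this
  obtain ⟨c, hc⟩ := key
  refine circumradius_le (c := c) h0 fun x hx => ?_
  rw [mem_closedBall_comm]
  exact Set.mem_iInter.1 hc ⟨x, hx⟩

/-- A simplex of largest Jung ratio exists, and its ratio is smaller than one. -/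
theorem exists_extremal_simplex {n : ℕ} (hn : 1 ≤ n) (hE : finrank ℝ E = n) :
    ∃ p : Fin (n + 1) → E, (Set.range p).Nontrivial ∧
      jungRatio (convexHull ℝ (Set.range p)) < 1 ∧
      ∀ K : Set E, IsConvexBody K → jungRatio K ≤ jungRatio (convexHull ℝ (Set.range p)) := by
  let X : Set (Fin (n + 1) → E) := {p | p 0 = 0 ∧ ∀ i j, dist (p i) (p j) ≤ 1}
  have hX : IsCompact X := by
    refine (isCompact_closedBall (0 : Fin (n + 1) → E) 1).of_isClosed_subset ?_ ?_
    · refine (isClosed_eq (continuous_apply 0) continuous_const).inter ?_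
      have e : {p : Fin (n + 1) → E | ∀ i j, dist (p i) (p j) ≤ 1} =
          ⋂ i, ⋂ j, {p | dist (p i) (p j) ≤ 1} := by ext; simp
      change IsClosed {p : Fin (n + 1) → E | ∀ i j, dist (p i) (p j) ≤ 1}
      rw [e]
      exact isClosed_iInter fun i => isClosed_iInter fun j => isClosed_le
        ((continuous_apply i).dist (continuous_apply j)) continuous_const
    · rintro p ⟨h0, h⟩
      rw [mem_closedBall, dist_pi_le_iff zero_le_one]
      intro i
      simpa [h0] using h i 0
  have hX0 : (0 : Fin (n + 1) → E) ∈ X := ⟨rfl, by simp⟩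
  obtain ⟨p, hp, hmax⟩ := hX.exists_isMaxOn ⟨0, hX0⟩
    (lipschitzWith_circumradius_range (E := E)).continuous.continuousOn
  set J := circumradius (Set.range p) with hJ
  have hJ1 : J < 1 := by
    refine (circumradius_range_le hn one_pos hp.2).trans_lt ?_
    rw [mul_one, div_lt_one (by positivity)]
    linarith
  have hscale : ∀ q : Fin (n + 1) → E, ∀ D : ℝ, 0 < D → (∀ i j, dist (q i) (q j) ≤ D) →
      circumradius (Set.range q) ≤ D * J := by
    intro q D hD hq
    let q' : Fin (n + 1) → E := fun i => D⁻¹ • (q i - q 0)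
    have hq' : q' ∈ X := by
      refine ⟨by simp [q'], fun i j => ?_⟩
      simp only [q']
      rw [dist_smul₀, dist_sub_right, norm_inv, Real.norm_of_nonneg hD.le, inv_mul_le_iff₀ hD,
        mul_one]
      exact hq i j
    have e : Set.range q = (fun x => D • x + q 0) '' Set.range q' := by
      rw [← Set.range_comp]
      congr 1
      ext i
      simp [q', smul_smul, hD.ne']
    rw [e]
    exact (circumradius_image_smul_add_le (isBounded_range q') hD _).trans
      (mul_le_mul_of_nonneg_left (hmax hq') hD.le)
  have hJ0 : 0 < J := by
    have : Nontrivial E := Module.nontrivial_of_finrank_pos (R := ℝ) (by omega)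
    obtain ⟨x, hx⟩ := exists_ne (0 : E)
    let q : Fin (n + 1) → E := Function.update 0 (Fin.last n) x
    have hne : (0 : Fin (n + 1)) ≠ Fin.last n := by
      simp [Fin.ext_iff]; omega
    have hq : (Set.range q).Nontrivial :=
      ⟨q 0, ⟨0, rfl⟩, q (Fin.last n), ⟨_, rfl⟩, by simp [q, hne, hx.symm]⟩
    have h1 := Metric.diam_pos hq (isBounded_range q)
    have h2 := diam_le_two_mul_circumradius (isBounded_range q)
    have h3 := hscale q _ h1 fun i j =>
      dist_le_diam_of_mem (isBounded_range q) ⟨i, rfl⟩ ⟨j, rfl⟩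
    by_contra hneg
    have := mul_nonpos_of_nonneg_of_nonpos h1.le (not_lt.1 hneg)
    linarith
  have hnt := nontrivial_of_circumradius_pos hJ0
  have hd0 := Metric.diam_pos hnt (isBounded_range p)
  -- A diameter d < 1 would give J ≤ d J by rescaling, against J > 0.
  have hd : diam (Set.range p) = 1 := by
    refine le_antisymm (diam_le_of_forall_dist_le zero_le_one ?_) ?_
    · rintro _ ⟨i, rfl⟩ _ ⟨j, rfl⟩
      exact hp.2 i j
    · have := hscale p _ hd0 fun i j =>
        dist_le_diam_of_mem (isBounded_range p) ⟨i, rfl⟩ ⟨j, rfl⟩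
      exact le_of_mul_le_mul_right (by rwa [one_mul]) hJ0
  have hpJ : jungRatio (convexHull ℝ (Set.range p)) = J := by
    rw [jungRatio_convexHull, hd, div_one]
  refine ⟨p, hnt, hpJ.trans_lt hJ1, fun K hK => ?_⟩
  obtain ⟨q, hq, hR⟩ := exists_simplex_circumradius_eq hE hK.1 hK.2.2.nonempty
  rw [hpJ, jungRatio, div_le_iff₀' hK.diam_pos, ← hR]
  exact hscale q _ hK.diam_pos fun i j => dist_le_diam_of_mem hK.1.isBounded (hq i) (hq j)

end Simplices

/-! ### Complete bodies, completions and asymmetry -/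

section Complete

variable {E : Type*} [NormedAddCommGroup E]

theorem diam_union_singleton_le {K : Set E} (hK : Bornology.IsBounded K) {D : ℝ} (hD : diam K ≤ D)
    {x : E} (hx : ∀ y ∈ K, dist x y ≤ D) : diam (K ∪ {x}) ≤ D := by
  have h0 : 0 ≤ D := diam_nonneg.trans hD
  refine diam_le_of_forall_dist_le h0 ?_
  rintro a (ha | rfl) b (hb | rfl)
  · exact (dist_le_diam_of_mem hK ha hb).trans hD
  · rw [dist_comm]; exact hx a ha
  · exact hx b hb
  · simpa using h0

variable [NormedSpace ℝ E]

/-- The spherical intersection property of complete bodies. -/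
theorem IsCompleteBody.mem_of_forall_dist_le {K : Set E} (hK : IsCompleteBody K) {x : E}
    (hx : ∀ y ∈ K, dist x y ≤ diam K) : x ∈ K := by
  by_contra h
  exact (hK.2 x h).not_ge (diam_union_singleton_le hK.1.1.isBounded le_rfl hx)

theorem IsCompleteBody.closedBall_subset {K : Set E} (hK : IsCompleteBody K) {c : E} {r : ℝ}
    (h : K ⊆ closedBall c r) : closedBall c (diam K - r) ⊆ K := by
  intro x hx
  refine hK.mem_of_forall_dist_le fun y hy => ?_
  have h1 : dist y c ≤ r := h hy
  have h2 : dist x c ≤ diam K - r := hx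
  have := dist_triangle_right x y c
  linarith

/-- A Zorn-maximal set is closed and convex, since closure and convex hull preserve the diameter. -/
theorem IsConvexBody.exists_completion [FiniteDimensional ℝ E] {S : Set E} (hS : IsConvexBody S) :
    ∃ K, IsCompletion S K := by
  set D := diam S
  -- Pairwise distances are bounded, because `diam` is 0 on unbounded sets.
  let F : Set (Set E) := {K | ∀ x ∈ K, ∀ y ∈ K, dist x y ≤ D}
  have hSF : S ∈ F := fun x hx y hy => dist_le_diam_of_mem hS.1.isBounded hx hy
  obtain ⟨K, hSK, hK, hmax⟩ := zorn_subset_nonempty F (by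
    intro c hc hchain _
    refine ⟨⋃₀ c, ?_, fun s hs => Set.subset_sUnion_of_mem hs⟩
    rintro x ⟨s, hs, hxs⟩ y ⟨t, ht, hyt⟩
    rcases hchain.total hs ht with h | h
    · exact hc ht x (h hxs) y hyt
    · exact hc hs x hxs y (h hyt)) S hSF
  have hbdd : Bornology.IsBounded K := isBounded_iff.2 ⟨D, fun x hx y hy => hK x hx y hy⟩
  have hD : diam K = D :=
    le_antisymm (diam_le_of_forall_dist_le diam_nonneg hK) (diam_mono hSK hbdd)
  have hmem : ∀ {L : Set E}, K ⊆ L → Bornology.IsBounded L → diam L ≤ D → L ⊆ K :=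
    fun hKL hL hLD => hmax (fun x hx y hy => (dist_le_diam_of_mem hL hx hy).trans hLD) hKL
  have hclosed : IsClosed K := isClosed_of_closure_subset
    (hmem subset_closure hbdd.closure (by rw [diam_closure, hD]))
  have hconv : Convex ℝ K := by
    have : convexHull ℝ K = K := (hmem (subset_convexHull ℝ K) (isBounded_convexHull.2 hbdd)
      (by rw [convexHull_diam, hD])).antisymm (subset_convexHull ℝ K)
    exact this ▸ convex_convexHull ℝ K
  refine ⟨K, hSK, ⟨⟨isCompact_of_isClosed_isBounded hclosed hbdd, hconv, hS.2.2.mono hSK⟩,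
    fun x hx => ?_⟩, hD⟩
  by_contra hle
  exact hx (hmem Set.subset_union_left (hbdd.union Bornology.isBounded_singleton)
    ((not_lt.1 hle).trans_eq hD) (Or.inr rfl))

theorem asymmetry_nonneg (K : Set E) : 0 ≤ asymmetry K :=
  Real.sInf_nonneg fun _ h => h.1.le

/-- The circumradius is bounded in terms of any admissible dilatation factor. -/
theorem circumradius_le_of_neg_subset {K : Set E} (hK : IsConvexBody K) {ρ : ℝ} (hρ : 0 < ρ)
    {c : E} (h : -K ⊆ {c} + ρ • K) : circumradius K ≤ ρ / (ρ + 1) * diam K := by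
  have hρ1 : 0 < ρ + 1 := by linarith
  have hd := Metric.diam_pos hK.2.2 hK.1.isBounded
  -- From -x = c + ρ k follows x + c / (ρ + 1) = ρ / (ρ + 1) · (x - k).
  refine circumradius_le (c := -(ρ + 1)⁻¹ • c) (by positivity) fun x hx => ?_
  obtain ⟨c', hc', y, ⟨k, hk, rfl⟩, e⟩ := h (Set.neg_mem_neg.2 hx)
  obtain rfl : c' = c := hc'
  have e' : x - -(ρ + 1)⁻¹ • c' = (ρ / (ρ + 1)) • (x - k) := by
    have hc : c' = -x - ρ • k := by
      rw [← e]; simp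
    have h1 : (ρ + 1)⁻¹ = 1 - ρ / (ρ + 1) := by field_simp; ring
    have h2 : (ρ + 1)⁻¹ * ρ = ρ / (ρ + 1) := by field_simp
    rw [hc, neg_smul, sub_neg_eq_add, smul_sub, smul_neg, smul_smul, h2, h1, sub_smul, one_smul,
      smul_sub]
    abel
  rw [mem_closedBall, dist_eq_norm, e', norm_smul, Real.norm_of_nonneg (by positivity),
    ← dist_eq_norm]
  exact mul_le_mul_of_nonneg_left (dist_le_diam_of_mem hK.1.isBounded hx hk) (by positivity)

/-- A complete body contained in a ball of radius `r` is covered, after reflection, by a translate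
of its dilate with factor `r / (diam K - r)`. -/
theorem IsCompleteBody.neg_subset {K : Set E} (hK : IsCompleteBody K) {c : E} {r : ℝ} (hr : 0 < r)
    (hrD : r < diam K) (h : K ⊆ closedBall c r) :
    -K ⊆ {-c - (r / (diam K - r)) • c} + (r / (diam K - r)) • K := by
  have hd : 0 < diam K - r := by linarith
  intro x hx
  set ρ := r / (diam K - r) with hρdef
  have hρ : 0 < ρ := by positivity
  -- The point c + ρ⁻¹ (x + c) is within r / ρ = D - r of c, hence in `K`.
  refine ⟨_, rfl, ρ • (c + ρ⁻¹ • (x + c)), ⟨_, hK.closedBall_subset h ?_, rfl⟩, ?_⟩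
  · have hx' : dist (-x) c ≤ r := h hx
    rw [dist_eq_norm, ← norm_neg, show -(-x - c) = x + c by abel] at hx'
    rw [mem_closedBall, dist_eq_norm, add_sub_cancel_left, norm_smul, norm_inv,
      Real.norm_of_nonneg hρ.le, inv_mul_le_iff₀ hρ, hρdef, div_mul_cancel₀ _ hd.ne']
    exact hx'
  · simp only [smul_add, smul_smul, mul_inv_cancel₀ hρ.ne', one_smul]
    abel

theorem IsCompleteBody.jungRatio_eq {K : Set E} (hK : IsCompleteBody K) (h1 : jungRatio K < 1) :
    jungRatio K = asymmetry K / (asymmetry K + 1) := by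
  have hb := hK.1.1.isBounded
  have hD := Metric.diam_pos hK.1.2.2 hb
  have hs := asymmetry_nonneg K
  have hRD : circumradius K < diam K := by rwa [jungRatio, div_lt_one hD] at h1
  have hle : ∀ r, circumradius K < r → r < diam K →
      (r / (diam K - r)) ∈ {ρ : ℝ | 0 < ρ ∧ ∃ c : E, -K ⊆ {c} + ρ • K} := by
    intro r hr hrD
    obtain ⟨c, hc⟩ := exists_ball_of_circumradius_lt hb hr
    have h0 : 0 < r := (circumradius_nonneg K).trans_lt hr
    exact ⟨div_pos h0 (by linarith), _, hK.neg_subset h0 hrD hc⟩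
  rw [jungRatio, div_eq_div_iff hD.ne' (by linarith)]
  apply le_antisymm
  · have : circumradius K / (diam K - circumradius K) ≤ asymmetry K := by
      obtain ⟨r, hr, hrD⟩ := exists_between hRD
      refine le_csInf ⟨_, hle r hr hrD⟩ ?_
      rintro ρ ⟨hρ, c, hc⟩
      have := circumradius_le_of_neg_subset hK.1 hρ hc
      rw [div_mul_eq_mul_div, le_div_iff₀ (by linarith)] at this
      rw [div_le_iff₀ (by linarith)]
      linarith
    rw [div_le_iff₀ (by linarith)] at this
    linarith
  · have : asymmetry K * diam K / (asymmetry K + 1) ≤ circumradius K := by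
      refine le_of_forall_gt_imp_ge_of_dense fun r hr => ?_
      rw [div_le_iff₀ (by linarith)]
      have h0 : 0 < r := (circumradius_nonneg K).trans_lt hr
      rcases lt_or_ge r (diam K) with hrD | hrD
      · have : asymmetry K ≤ r / (diam K - r) :=
          csInf_le ⟨0, fun _ h => h.1.le⟩ (hle r hr hrD)
        rw [le_div_iff₀ (by linarith)] at this
        linarith
      · have := mul_le_mul_of_nonneg_left hrD hs
        linarith
    rw [div_le_iff₀ (by linarith)] at this
    exact this

theorem IsCompletion.jungRatio_le {S K : Set E} (h : IsCompletion S K) :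
    jungRatio S ≤ jungRatio K := by
  rw [jungRatio, jungRatio, h.2.2]
  exact div_le_div_of_nonneg_right (circumradius_mono h.2.1.1.1.isBounded h.1) diam_nonneg

end Complete

end MinkowskiSpace

/-! ### The main theorem -/

open MinkowskiSpace in
theorem theorem2p3 {E : Type*} [NormedAddCommGroup E] [NormedSpace ℝ E] [FiniteDimensional ℝ E]
    (n : ℕ) (hn : 1 ≤ n) (hE : Module.finrank ℝ E = n) :
    -- the ratio of circumradius to diameter of every complete body
    (∀ K : Set E, MinkowskiSpace.IsCompleteBody K →
      MinkowskiSpace.jungRatio K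
        = MinkowskiSpace.asymmetry K / (MinkowskiSpace.asymmetry K + 1)) ∧
    -- both constants are maxima
    IsGreatest {t : ℝ | ∃ K : Set E, MinkowskiSpace.IsConvexBody K ∧
        t = MinkowskiSpace.jungRatio K} (MinkowskiSpace.jungConstant E) ∧
    IsGreatest {t : ℝ | ∃ K : Set E, MinkowskiSpace.IsCompleteBody K ∧
        t = MinkowskiSpace.asymmetry K} (MinkowskiSpace.asymmetryConstant E) ∧
    -- they determine each other
    MinkowskiSpace.jungConstant E
      = MinkowskiSpace.asymmetryConstant E / (MinkowskiSpace.asymmetryConstant E + 1) ∧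
    -- the complete bodies that attain the Jung constant
    (∀ K : Set E, MinkowskiSpace.IsCompleteBody K →
      (MinkowskiSpace.jungRatio K = MinkowskiSpace.jungConstant E ↔
        ∃ p : Fin (n + 1) → E,
          MinkowskiSpace.jungRatio (convexHull ℝ (Set.range p)) = MinkowskiSpace.jungConstant E ∧
          MinkowskiSpace.IsCompletion (convexHull ℝ (Set.range p)) K)) := by
  obtain ⟨p, hpn, hp1, hpmax⟩ := exists_extremal_simplex hn hE
  have hpb := isConvexBody_convexHull_range hpn
  have hJ : IsGreatest {t : ℝ | ∃ K : Set E, IsConvexBody K ∧ t = jungRatio K}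
      (jungRatio (convexHull ℝ (Set.range p))) := by
    refine ⟨⟨_, hpb, rfl⟩, ?_⟩
    rintro _ ⟨K, hK, rfl⟩
    exact hpmax K hK
  have hJeq : jungConstant E = jungRatio (convexHull ℝ (Set.range p)) := hJ.csSup_eq
  rw [← hJeq] at hJ hpmax hp1
  have h1 : ∀ K : Set E, IsCompleteBody K → jungRatio K = asymmetry K / (asymmetry K + 1) :=
    fun K hK => hK.jungRatio_eq ((hpmax K hK.1).trans_lt hp1)
  obtain ⟨M, hM⟩ := hpb.exists_completion
  have hMJ : jungRatio M = jungConstant E :=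
    (hpmax M hM.2.1.1).antisymm (hJeq.trans_le hM.jungRatio_le)
  have hA : IsGreatest {t : ℝ | ∃ K : Set E, IsCompleteBody K ∧ t = asymmetry K}
      (asymmetry M) := by
    refine ⟨⟨M, hM.2.1, rfl⟩, ?_⟩
    rintro _ ⟨K, hK, rfl⟩
    have h := hpmax K hK.1
    have hK0 := asymmetry_nonneg K
    have hM0 := asymmetry_nonneg M
    rw [← hMJ, h1 K hK, h1 M hM.2.1, div_le_div_iff₀ (by linarith) (by linarith)] at h
    linarith
  have hAeq : asymmetryConstant E = asymmetry M := hA.csSup_eq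
  refine ⟨h1, hJ, hAeq ▸ hA, by rw [hAeq, ← hMJ, h1 M hM.2.1], fun K hK => ⟨fun hKJ => ?_, ?_⟩⟩
  · obtain ⟨q, hq, hR⟩ := exists_simplex_circumradius_eq hE hK.1.1 hK.1.2.2.nonempty
    have hb := hK.1.1.isBounded
    have hD := hK.1.diam_pos
    have hR0 : 0 < circumradius K := by
      have := diam_le_two_mul_circumradius hb
      linarith
    have hqn := nontrivial_of_circumradius_pos (hR0.trans_eq hR.symm)
    have hqK : Set.range q ⊆ K := Set.range_subset_iff.2 hq
    have hd0 := Metric.diam_pos hqn (isBounded_range q)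
    -- The points share the circumradius of `K`; a smaller diameter would push their ratio above the
    -- Jung constant.
    have hdiam : Metric.diam K = Metric.diam (Set.range q) := by
      refine le_antisymm ?_ (Metric.diam_mono hqK hb)
      have h := hpmax _ (isConvexBody_convexHull_range hqn)
      rwa [jungRatio_convexHull, hR, ← hKJ, jungRatio, div_le_div_iff_of_pos_left hR0 hd0 hD] at h
    refine ⟨q, ?_, convexHull_min hqK hK.1.2.1, hK, by rw [convexHull_diam, hdiam]⟩
    rw [jungRatio_convexHull, hR, ← hdiam, ← hKJ, jungRatio]
  · rintro ⟨q, hq, hc⟩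
    exact (hpmax K hK.1).antisymm (hq ▸ hc.jungRatio_le)
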